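/- Let $\mathcal C$ be an additive braided tensor category with braiding $C$: a category with abelian Hom-groups, bilinear composition, a zero object and finite direct sums, together with a braided monoidal structure whose tensor product is bilinear on morphisms. Associativity constraints are suppressed; composition is written from right to left; $C_{12}=C\otimes \mathrm{id}$ and $C_{23}=\mathrm{id}\otimes C$ denote the braidings of the first two, resp. last two, of three tensor factors. The braiding is symmetric on a family of objects if $C_{U,V}=C_{V,U}^{-1}$ for all $U,V$ in it. **Definitions.** A braided Lie algebra $(L,[\,,])$ is an object $L$ on which $C$ is symmetric (i.e. on $\{L\}$) with a morphism $[\,,]:L\otimes L\to L$ such that $[\,,](\mathrm{id}+C)=0$ and $[\,,]([\,,]\otimes \mathrm{id})(\mathrm{id}+C_{12}C_{23}+C_{23}C_{12})=0$. A braided Lie coalgebra $(L,\delta)$ is an object $L$ on which $C$ is symmetric with a morphism $\delta:L\to L\otimes L$ such that $(\mathrm{id}+C)\delta=0$ and $(\mathrm{id}+C_{12}C_{23}+C_{23}C_{12})(\delta\otimes \mathrm{id})\delta=0$. Put $$\Gamma_L=\big(([\,,]\otimes \mathrm{id})(\mathrm{id}\otimes\delta)+(\mathrm{id}\otimes[\,,])(C\otimes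 \mathrm{id})(\mathrm{id}\otimes\delta)\big)(\mathrm{id}-C):L\otimes L\to L\otimes L .$$ A braided Lie bialgebra is a triple $(L,[\,,],\delta)$ which is a braided Lie algebra and a braided Lie coalgebra with $\delta[\,,]=\Gamma_L$. Let $A,H$ be objects of $\mathcal C$ such that $C$ is symmetric on $\{A,H\}$, and let $[\,,]_A,[\,,]_H$ be brackets, $\delta_A,\delta_H$ cobrackets, and $\alpha:H\otimes A\to A$, $\beta:H\otimes A\to H$, $\phi:A\to H\otimes A$, $\psi:H\to H\otimes A$ morphisms in $\mathcal C$ (subscripts on brackets and cobrackets are omitted when clear). $(A,H,\alpha,\beta)$ is a *matched pair of braided Lie algebras* if $(A,[\,,])$ and $(H,[\,,])$ are braided Lie algebras and * (left module) $\alpha([\,,]\otimes \mathrm{id})=\alpha(\mathrm{id}\otimes\alpha)-\alpha(\mathrm{id}\otimes\alpha)C_{12}$ on $H\otimes H\otimes A$; * (right module) $\beta(\mathrm{id}\otimes[\,,])=\beta(\beta\otimes \mathrm{id})-\beta(\beta\otimes \mathrm{id})C_{23}$ on $H\otimes A\otimes A$; * (M1) $\alpha(\mathrm{id}\otimes[\,,])=[\,,](\alpha\otimes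 \mathrm{id})+[\,,](\mathrm{id}\otimes\alpha)C_{12}+\alpha(\beta\otimes \mathrm{id})-\alpha(\beta\otimes \mathrm{id})C_{23}$ on $H\otimes A\otimes A$; * (M2) $\beta([\,,]\otimes \mathrm{id})=[\,,](\mathrm{id}\otimes\beta)+[\,,](\beta\otimes \mathrm{id})C_{23}+\beta(\mathrm{id}\otimes\alpha)-\beta(\mathrm{id}\otimes\alpha)C_{12}$ on $H\otimes H\otimes A$. $(A,H,\phi,\psi)$ is a *matched pair of braided Lie coalgebras* if $(A,\delta)$ and $(H,\delta)$ are braided Lie coalgebras and * (left comodule) $(\delta\otimes \mathrm{id})\phi=(\mathrm{id}\otimes\phi)\phi-C_{12}(\mathrm{id}\otimes\phi)\phi$; * (right comodule) $(\mathrm{id}\otimes\delta)\psi=(\psi\otimes \mathrm{id})\psi-C_{23}(\psi\otimes \mathrm{id})\psi$; * (CM1) $(\mathrm{id}\otimes\delta)\phi=(\phi\otimes \mathrm{id})\delta+C_{12}(\mathrm{id}\otimes\phi)\delta+(\psi\otimes \mathrm{id})\phi-C_{23}(\psi\otimes \mathrm{id})\phi$; * (CM2) $(\delta\otimes \mathrm{id})\psi=(\mathrm{id}\otimes\psi)\delta+C_{23}(\psi\otimes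 \mathrm{id})\delta+(\mathrm{id}\otimes\phi)\psi-C_{12}(\mathrm{id}\otimes\phi)\psi$. $(A,H,\alpha,\beta,\phi,\psi)$ is a *double matched pair* if $A$ and $H$ are braided Lie algebras and braided Lie coalgebras and * (SLB on $A\otimes A$) $\delta_A[\,,]_A=\Gamma_A-S_A$, where $S_A=(\alpha\otimes \mathrm{id})C_{12}(\mathrm{id}\otimes\phi)+(\mathrm{id}\otimes\alpha)C_{12}(\phi\otimes \mathrm{id})-(\alpha\otimes \mathrm{id})C_{23}(\phi\otimes \mathrm{id})-(\mathrm{id}\otimes\alpha)C_{12}C_{23}C_{12}(\mathrm{id}\otimes\phi)$; * (SLB on $H\otimes H$) $\delta_H[\,,]_H=\Gamma_H-S_H$, where $S_H=(\mathrm{id}\otimes\beta)C_{23}(\psi\otimes \mathrm{id})+(\beta\otimes \mathrm{id})C_{23}(\mathrm{id}\otimes\psi)-(\mathrm{id}\otimes\beta)C_{12}(\mathrm{id}\otimes\psi)-(\beta\otimes \mathrm{id})C_{23}C_{12}C_{23}(\psi\otimes \mathrm{id})$; * (B1) $\delta\alpha=(\alpha\otimes \mathrm{id})(\mathrm{id}\otimes\delta)+(\mathrm{id}\otimes\alpha)C_{12}(\mathrm{id}\otimes\delta)+(\alpha\otimes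 \mathrm{id})C_{23}(\psi\otimes \mathrm{id})-(\mathrm{id}\otimes\alpha)C_{12}(\psi\otimes \mathrm{id})$ on $H\otimes A$; * (B2) $\delta\beta=(\mathrm{id}\otimes\beta)(\delta\otimes \mathrm{id})+(\beta\otimes \mathrm{id})C_{23}(\delta\otimes \mathrm{id})+(\mathrm{id}\otimes\beta)C_{12}(\mathrm{id}\otimes\phi)-(\beta\otimes \mathrm{id})C_{23}(\mathrm{id}\otimes\phi)$ on $H\otimes A$; * (B3) $\phi[\,,]=(\mathrm{id}\otimes[\,,])(\phi\otimes \mathrm{id})+(\mathrm{id}\otimes[\,,])C_{12}(\mathrm{id}\otimes\phi)+(\beta\otimes \mathrm{id})C_{23}(\phi\otimes \mathrm{id})-(\beta\otimes \mathrm{id})C_{12}(\mathrm{id}\otimes\phi)$ on $A\otimes A$; * (B4) $\psi[\,,]=([\,,]\otimes \mathrm{id})(\mathrm{id}\otimes\psi)+([\,,]\otimes \mathrm{id})C_{23}(\psi\otimes \mathrm{id})+(\mathrm{id}\otimes\alpha)C_{12}(\mathrm{id}\otimes\psi)-(\mathrm{id}\otimes\alpha)C_{23}(\psi\otimes \mathrm{id})$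 on $H\otimes H$; * (B5) $\phi\alpha+\psi\beta=([\,,]\otimes \mathrm{id})(\mathrm{id}\otimes\phi)+(\mathrm{id}\otimes\alpha)C_{12}(\mathrm{id}\otimes\phi)+(\mathrm{id}\otimes\alpha)(\delta\otimes \mathrm{id})+(\mathrm{id}\otimes[\,,])(\psi\otimes \mathrm{id})+(\beta\otimes \mathrm{id})C_{23}(\psi\otimes \mathrm{id})+(\beta\otimes \mathrm{id})(\mathrm{id}\otimes\delta)$ on $H\otimes A$. The *double bicrosssum* is $D=A\oplus H$ with the bracket $[\,,]_D$ given on the summands of $D\otimes D$ by $[\,,]_A$ on $A\otimes A$, $[\,,]_H$ on $H\otimes H$, $\alpha+\beta$ on $H\otimes A$ and $-(\alpha+\beta)C_{A,H}$ on $A\otimes H$, and the cobracket $\delta_D$ given by $\delta_A+\phi-C_{H,A}\phi$ on $A$ and $\delta_H+\psi-C_{H,A}\psi$ on $H$. **Theorem.** If $(A,H,\alpha,\beta)$ is a matched pair of braided Lie algebras, $(A,H,\phi,\psi)$ is a matched pair of braided Lie coalgebras, and $(A,H,\alpha,\beta,\phi,\psi)$ is a double matched pair, then $(A\oplus H,[\,,]_D,\delta_D)$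 is a braided Lie bialgebra in $\mathcal C$. -/

import Mathlib

open CategoryTheory MonoidalCategory BraidedCategory Limits

universe v u

namespace BraidedLie

section Strands

variable {C : Type u} [Category.{v} C] [MonoidalCategory C]

/-- `f ⊗ id : X ⊗ Y ⊗ Z ⟶ W ⊗ Z`, for a morphism `f : X ⊗ Y ⟶ W` (triple tensor products are
bracketed to the right). -/
def merge12 {X Y W : C} (f : X ⊗ Y ⟶ W) (Z : C) : X ⊗ Y ⊗ Z ⟶ W ⊗ Z :=
  (α_ X Y Z).inv ≫ f ▷ Z

/-- `f ⊗ id : W ⊗ Z ⟶ X ⊗ Y ⊗ Z`, for a morphism `f : W ⟶ X ⊗ Y`. -/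
def split12 {X Y W : C} (f : W ⟶ X ⊗ Y) (Z : C) : W ⊗ Z ⟶ X ⊗ Y ⊗ Z :=
  f ▷ Z ≫ (α_ X Y Z).hom

variable [BraidedCategory C]

/-- The braiding of the first two of three factors. -/
def swap12 (X Y Z : C) : X ⊗ Y ⊗ Z ⟶ Y ⊗ X ⊗ Z :=
  (α_ X Y Z).inv ≫ (β_ X Y).hom ▷ Z ≫ (α_ Y X Z).hom

/-- The braiding of the last two of three factors. -/
def swap23 (X Y Z : C) : X ⊗ Y ⊗ Z ⟶ X ⊗ Z ⊗ Y :=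
  X ◁ (β_ Y Z).hom

/-- The braiding is symmetric on the family `S` of objects. -/
def IsSymmetricOn (S : Set C) : Prop :=
  ∀ U ∈ S, ∀ V ∈ S, (β_ U V).hom = (β_ V U).inv

end Strands

section Structures

variable {C : Type u} [Category.{v} C] [Preadditive C] [MonoidalCategory C] [BraidedCategory C]

/-- A braided Lie algebra: an object on which the braiding is symmetric, with a bracket satisfying
braided anti-symmetry and the braided Jacobi identity. -/
structure IsLieAlgebra (L : C) (br : L ⊗ L ⟶ L) : Prop where
  symmetric : IsSymmetricOn {L}
  antisymm : br + (β_ L L).hom ≫ br = 0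
  jacobi : (𝟙 (L ⊗ L ⊗ L) + swap23 L L L ≫ swap12 L L L + swap12 L L L ≫ swap23 L L L) ≫
    merge12 br L ≫ br = 0

/-- A braided Lie coalgebra: an object on which the braiding is symmetric, with a cobracket
satisfying braided anti-co-symmetry and the braided co-Jacobi identity. -/
structure IsLieCoalgebra (L : C) (δ : L ⟶ L ⊗ L) : Prop where
  symmetric : IsSymmetricOn {L}
  coantisymm : δ + δ ≫ (β_ L L).hom = 0
  cojacobi : δ ≫ split12 δ L ≫
    (𝟙 (L ⊗ L ⊗ L) + swap23 L L L ≫ swap12 L L L + swap12 L L L ≫ swap23 L L L) = 0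

/-- The right-hand side of the Lie bialgebra compatibility; on elements (with trivial signs)
`[x, y₁] ⊗ y₂ + y₁ ⊗ [x, y₂] - [y, x₁] ⊗ x₂ - x₁ ⊗ [y, x₂]`. -/
def cocycleRHS {L : C} (br : L ⊗ L ⟶ L) (δ : L ⟶ L ⊗ L) : L ⊗ L ⟶ L ⊗ L :=
  L ◁ δ ≫ merge12 br L
  + L ◁ δ ≫ swap12 L L L ≫ L ◁ br
  - (β_ L L).hom ≫ L ◁ δ ≫ merge12 br L
  - (β_ L L).hom ≫ L ◁ δ ≫ swap12 L L L ≫ L ◁ br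

/-- A braided Lie bialgebra. -/
structure IsLieBialgebra (L : C) (br : L ⊗ L ⟶ L) (δ : L ⟶ L ⊗ L) : Prop where
  lieAlgebra : IsLieAlgebra L br
  lieCoalgebra : IsLieCoalgebra L δ
  compat : br ≫ δ = cocycleRHS br δ

variable {A H : C}

/-- `(A, α)` is a left module over the braided Lie algebra `(H, brH)`. -/
def IsLeftModule (brH : H ⊗ H ⟶ H) (α : H ⊗ A ⟶ A) : Prop :=
  merge12 brH A ≫ α = H ◁ α ≫ α - swap12 H H A ≫ H ◁ α ≫ α

/-- `(H, β)` is a right module over the braided Lie algebra `(A, brA)`. -/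
def IsRightModule (brA : A ⊗ A ⟶ A) (β : H ⊗ A ⟶ H) : Prop :=
  H ◁ brA ≫ β = merge12 β A ≫ β - swap23 H A A ≫ merge12 β A ≫ β

/-- `(A, φ)` is a left comodule over the braided Lie coalgebra `(H, δH)`. -/
def IsLeftComodule (δH : H ⟶ H ⊗ H) (φ : A ⟶ H ⊗ A) : Prop :=
  φ ≫ split12 δH A = φ ≫ H ◁ φ - φ ≫ H ◁ φ ≫ swap12 H H A

/-- `(H, ψ)` is a right comodule over the braided Lie coalgebra `(A, δA)`. -/
def IsRightComodule (δA : A ⟶ A ⊗ A) (ψ : H ⟶ H ⊗ A) : Prop :=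
  ψ ≫ H ◁ δA = ψ ≫ split12 ψ A - ψ ≫ split12 ψ A ≫ swap23 H A A

/-- A matched pair of braided Lie algebras. -/
structure IsMatchedPairLieAlgebras (brA : A ⊗ A ⟶ A) (brH : H ⊗ H ⟶ H)
    (α : H ⊗ A ⟶ A) (β : H ⊗ A ⟶ H) : Prop where
  lieAlgebra_left : IsLieAlgebra A brA
  lieAlgebra_right : IsLieAlgebra H brH
  leftModule : IsLeftModule brH α
  rightModule : IsRightModule brA β
  m1 : H ◁ brA ≫ α =
    merge12 α A ≫ brA
    + swap12 H A A ≫ A ◁ α ≫ brA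
    + merge12 β A ≫ α
    - swap23 H A A ≫ merge12 β A ≫ α
  m2 : merge12 brH A ≫ β =
    H ◁ β ≫ brH
    + swap23 H H A ≫ merge12 β H ≫ brH
    + H ◁ α ≫ β
    - swap12 H H A ≫ H ◁ α ≫ β

/-- A matched pair of braided Lie coalgebras. -/
structure IsMatchedPairLieCoalgebras (δA : A ⟶ A ⊗ A) (δH : H ⟶ H ⊗ H)
    (φ : A ⟶ H ⊗ A) (ψ : H ⟶ H ⊗ A) : Prop where
  lieCoalgebra_left : IsLieCoalgebra A δA
  lieCoalgebra_right : IsLieCoalgebra H δH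
  leftComodule : IsLeftComodule δH φ
  rightComodule : IsRightComodule δA ψ
  cm1 : φ ≫ H ◁ δA =
    δA ≫ split12 φ A
    + δA ≫ A ◁ φ ≫ swap12 A H A
    + φ ≫ split12 ψ A
    - φ ≫ split12 ψ A ≫ swap23 H A A
  cm2 : ψ ≫ split12 δH A =
    δH ≫ H ◁ ψ
    + δH ≫ split12 ψ H ≫ swap23 H A H
    + ψ ≫ H ◁ φ
    - ψ ≫ H ◁ φ ≫ swap12 H H A

/-- The infinitesimal braiding of `A`, formed from the left action `α` and left coaction `φ`. -/
def leftInfBraiding (α : H ⊗ A ⟶ A) (φ : A ⟶ H ⊗ A) : A ⊗ A ⟶ A ⊗ A :=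
  A ◁ φ ≫ swap12 A H A ≫ merge12 α A
  + split12 φ A ≫ swap12 H A A ≫ A ◁ α
  - split12 φ A ≫ swap23 H A A ≫ merge12 α A
  - A ◁ φ ≫ swap12 A H A ≫ swap23 H A A ≫ swap12 H A A ≫ A ◁ α

/-- The infinitesimal braiding of `H`, formed from the right action `β` and right coaction `ψ`:
the left-right mirror image of `leftInfBraiding`. -/
def rightInfBraiding (β : H ⊗ A ⟶ H) (ψ : H ⟶ H ⊗ A) : H ⊗ H ⟶ H ⊗ H :=
  split12 ψ H ≫ swap23 H A H ≫ H ◁ β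
  + H ◁ ψ ≫ swap23 H H A ≫ merge12 β H
  - H ◁ ψ ≫ swap12 H H A ≫ H ◁ β
  - split12 ψ H ≫ swap23 H A H ≫ swap12 H H A ≫ swap23 H H A ≫ merge12 β H

/-- A double matched pair. -/
structure IsDoubleMatchedPair (brA : A ⊗ A ⟶ A) (brH : H ⊗ H ⟶ H)
    (δA : A ⟶ A ⊗ A) (δH : H ⟶ H ⊗ H) (α : H ⊗ A ⟶ A) (β : H ⊗ A ⟶ H)
    (φ : A ⟶ H ⊗ A) (ψ : H ⟶ H ⊗ A) : Prop where
  lieAlgebra_left : IsLieAlgebra A brA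
  lieAlgebra_right : IsLieAlgebra H brH
  lieCoalgebra_left : IsLieCoalgebra A δA
  lieCoalgebra_right : IsLieCoalgebra H δH
  slb_left : brA ≫ δA = cocycleRHS brA δA - leftInfBraiding α φ
  slb_right : brH ≫ δH = cocycleRHS brH δH - rightInfBraiding β ψ
  b1 : α ≫ δA =
    H ◁ δA ≫ merge12 α A
    + H ◁ δA ≫ swap12 H A A ≫ A ◁ α
    + split12 ψ A ≫ swap23 H A A ≫ merge12 α A
    - split12 ψ A ≫ swap12 H A A ≫ A ◁ α
  b2 : β ≫ δH =
    split12 δH A ≫ H ◁ β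
    + split12 δH A ≫ swap23 H H A ≫ merge12 β H
    + H ◁ φ ≫ swap12 H H A ≫ H ◁ β
    - H ◁ φ ≫ swap23 H H A ≫ merge12 β H
  b3 : brA ≫ φ =
    split12 φ A ≫ H ◁ brA
    + A ◁ φ ≫ swap12 A H A ≫ H ◁ brA
    + split12 φ A ≫ swap23 H A A ≫ merge12 β A
    - A ◁ φ ≫ swap12 A H A ≫ merge12 β A
  b4 : brH ≫ ψ =
    H ◁ ψ ≫ merge12 brH A
    + split12 ψ H ≫ swap23 H A H ≫ merge12 brH A
    + H ◁ ψ ≫ swap12 H H A ≫ H ◁ α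
    - split12 ψ H ≫ swap23 H A H ≫ H ◁ α
  b5 : α ≫ φ + β ≫ ψ =
    H ◁ φ ≫ merge12 brH A
    + H ◁ φ ≫ swap12 H H A ≫ H ◁ α
    + split12 δH A ≫ H ◁ α
    + split12 ψ A ≫ H ◁ brA
    + split12 ψ A ≫ swap23 H A A ≫ merge12 β A
    + H ◁ δA ≫ merge12 β A

variable [HasBinaryBiproducts C]

/-- The bracket of the double bicrosssum on `A ⊕ H`. -/
noncomputable def doubleBracket (brA : A ⊗ A ⟶ A) (brH : H ⊗ H ⟶ H)
    (α : H ⊗ A ⟶ A) (β : H ⊗ A ⟶ H) : (A ⊞ H) ⊗ (A ⊞ H) ⟶ A ⊞ H :=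
  ((biprod.fst ⊗ₘ biprod.fst) ≫ brA
    + (biprod.snd ⊗ₘ biprod.fst) ≫ α
    - (biprod.fst ⊗ₘ biprod.snd) ≫ (β_ A H).hom ≫ α) ≫ biprod.inl
  + ((biprod.snd ⊗ₘ biprod.snd) ≫ brH
    + (biprod.snd ⊗ₘ biprod.fst) ≫ β
    - (biprod.fst ⊗ₘ biprod.snd) ≫ (β_ A H).hom ≫ β) ≫ biprod.inr

/-- The cobracket of the double bicrosssum on `A ⊕ H`. -/
noncomputable def doubleCobracket (δA : A ⟶ A ⊗ A) (δH : H ⟶ H ⊗ H)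
    (φ : A ⟶ H ⊗ A) (ψ : H ⟶ H ⊗ A) : A ⊞ H ⟶ (A ⊞ H) ⊗ (A ⊞ H) :=
  biprod.fst ≫ (δA ≫ (biprod.inl ⊗ₘ biprod.inl)
    + φ ≫ (biprod.inr ⊗ₘ biprod.inl)
    - φ ≫ (β_ H A).hom ≫ (biprod.inl ⊗ₘ biprod.inr))
  + biprod.snd ≫ (δH ≫ (biprod.inr ⊗ₘ biprod.inr)
    + ψ ≫ (biprod.inr ⊗ₘ biprod.inl)
    - ψ ≫ (β_ H A).hom ≫ (biprod.inl ⊗ₘ biprod.inr))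

end Structures

end BraidedLie

/-! Write `X` for `A ⊞ H`. Composing with projections and inclusions turns every structure map into
a map `X ⊗ X ⟶ X` or `X ⟶ X ⊗ X` (`extendBracket`, `extendCobracket`). All the axioms survive with
both objects replaced by `X`, since each lives on one summand and both sides vanish on the others.
The double bicrosssum then becomes a signed sum of maps on a single object (`totalBracket`,
`totalCobracket`), and `X` inherits the symmetry of the braiding, so permutations of strands obey
the symmetric group relations.

Expanding a bialgebra axiom on these sums gives many composites. Those whose connecting strand would
have to lie in both summands vanish by orthogonality of the two projectors (`merge12_comp_eq_zero`,
`comp_split12_eq_zero`, `comp_eq_zero_of_support`, `loop_eq_zero`). The others are brought to normal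
form, where the axioms are linear relations that cancel everything:

- For Jacobi, the cyclic sum absorbs even permutations, so every nested bracket becomes `cyclicSum`,
at most one `swap12`, then `merge12`. The module axioms, M1 and M2 rewrite each bracket followed by
an action. Co-Jacobi is dual.

- For compatibility, every composite of one cobracket and one bracket joined along a strand is a
`loop` with braidings around it. The right-hand side is the two-sided antisymmetrization of one
`loop`; SLB and B1–B5 compute the left-hand side. The terms `S_A` and `S_H` account for loops whose
inputs and outputs lie in one summand and whose connecting strand runs through the other. -/

namespace BraidedLie

/-! ### Permutations of strands, Yang–Baxter and cyclic sums -/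

section SingleObject

variable {C : Type u} [Category.{v} C] [MonoidalCategory C] [BraidedCategory C] {X : C}

theorem swap23_comp_swap23 (hX : (β_ X X).hom ≫ (β_ X X).hom = 𝟙 _) (Z : C) :
    swap23 Z X X ≫ swap23 Z X X = 𝟙 _ := by
  simp [swap23, ← whiskerLeft_comp, hX]

theorem swap23_comp_swap23_assoc (hX : (β_ X X).hom ≫ (β_ X X).hom = 𝟙 _) (Z : C)
    {T : C} (k : _ ⟶ T) :
    swap23 Z X X ≫ swap23 Z X X ≫ k = k := by
  simpa only [Category.assoc, Category.id_comp] using swap23_comp_swap23 hX Z =≫ k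

theorem swap12_comp_swap12 (hX : (β_ X X).hom ≫ (β_ X X).hom = 𝟙 _) (Z : C) :
    swap12 X X Z ≫ swap12 X X Z = 𝟙 _ := by
  simp [swap12, ← comp_whiskerRight_assoc, hX]

theorem swap12_comp_swap12_assoc (hX : (β_ X X).hom ≫ (β_ X X).hom = 𝟙 _) (Z : C)
    {T : C} (k : _ ⟶ T) :
    swap12 X X Z ≫ swap12 X X Z ≫ k = k := by
  simpa only [Category.assoc, Category.id_comp] using swap12_comp_swap12 hX Z =≫ k

theorem swap12_swap23_swap12 (X Y Z : C) :
    swap12 X Y Z ≫ swap23 Y X Z ≫ swap12 Y Z X = swap23 X Y Z ≫ swap12 X Z Y ≫ swap23 Z X Y := by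
  simpa [swap12, swap23] using yang_baxter X Y Z

theorem swap12_swap23_swap12_assoc (X Y Z : C) {T : C} (k : _ ⟶ T) :
    swap12 X Y Z ≫ swap23 Y X Z ≫ swap12 Y Z X ≫ k =
      swap23 X Y Z ≫ swap12 X Z Y ≫ swap23 Z X Y ≫ k := by
  simpa only [Category.assoc] using swap12_swap23_swap12 X Y Z =≫ k

theorem merge12_comp_braiding {X Y W : C} (f : X ⊗ Y ⟶ W) (Z : C) :
    merge12 f Z ≫ (β_ W Z).hom = swap23 X Y Z ≫ swap12 X Z Y ≫ Z ◁ f := by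
  simp [merge12, swap12, swap23]

theorem merge12_comp_braiding_assoc {X Y W : C} (f : X ⊗ Y ⟶ W) (Z : C)
    {T : C} (k : _ ⟶ T) :
    merge12 f Z ≫ (β_ W Z).hom ≫ k = swap23 X Y Z ≫ swap12 X Z Y ≫ Z ◁ f ≫ k := by
  simpa only [Category.assoc] using merge12_comp_braiding f Z =≫ k

theorem braiding_comp_whiskerLeft {X Y W : C} (f : W ⟶ X ⊗ Y) (Z : C) :
    (β_ W Z).hom ≫ Z ◁ f = split12 f Z ≫ swap23 X Y Z ≫ swap12 X Z Y := by
  simp [split12, swap12, swap23, ← braiding_naturality_left, braiding_tensor_left_hom]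

theorem braiding_comp_whiskerLeft_assoc {X Y W : C} (f : W ⟶ X ⊗ Y) (Z : C)
    {T : C} (k : _ ⟶ T) :
    (β_ W Z).hom ≫ Z ◁ f ≫ k = split12 f Z ≫ swap23 X Y Z ≫ swap12 X Z Y ≫ k := by
  simpa only [Category.assoc] using braiding_comp_whiskerLeft f Z =≫ k

theorem swap12_comp_merge12 {X Y W : C} (f : Y ⊗ X ⟶ W) (Z : C) :
    swap12 X Y Z ≫ merge12 f Z = merge12 ((β_ X Y).hom ≫ f) Z := by
  simp [merge12, swap12]

theorem split12_comp_swap12 {X Y W : C} (f : W ⟶ X ⊗ Y) (Z : C) :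
    split12 f Z ≫ swap12 X Y Z = split12 (f ≫ (β_ X Y).hom) Z := by
  simp [split12, swap12]

theorem whiskerLeft_comp_swap23 {X Y W : C} (f : W ⟶ X ⊗ Y) (Z : C) :
    Z ◁ f ≫ swap23 Z X Y = Z ◁ (f ≫ (β_ X Y).hom) := by
  simp [swap23]

theorem whiskerLeft_comp_swap23_assoc {X Y W : C} (f : W ⟶ X ⊗ Y) (Z : C)
    {T : C} (k : _ ⟶ T) :
    Z ◁ f ≫ swap23 Z X Y ≫ k = Z ◁ (f ≫ (β_ X Y).hom) ≫ k := by
  simpa only [Category.assoc] using whiskerLeft_comp_swap23 f Z =≫ k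

/-- The sum of the cyclic permutations of three factors. -/
def cyclicSum [Preadditive C] (X : C) : X ⊗ X ⊗ X ⟶ X ⊗ X ⊗ X :=
  𝟙 (X ⊗ X ⊗ X) + swap23 X X X ≫ swap12 X X X + swap12 X X X ≫ swap23 X X X

section CyclicSum

variable [Preadditive C]

/-- The cyclic sum runs over the even permutations of three strands; multiplied by any transposition
it gives the sum over the odd ones. -/
theorem cyclicSum_comp_swap23 (hX : (β_ X X).hom ≫ (β_ X X).hom = 𝟙 _) :
    cyclicSum X ≫ swap23 X X X = cyclicSum X ≫ swap12 X X X := by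
  simp [cyclicSum, swap12_comp_swap12 hX, swap23_comp_swap23 hX, swap12_swap23_swap12,
    Preadditive.add_comp]
  abel

theorem cyclicSum_comp_swap23_assoc (hX : (β_ X X).hom ≫ (β_ X X).hom = 𝟙 _)
    {T : C} (k : _ ⟶ T) :
    cyclicSum X ≫ swap23 X X X ≫ k = cyclicSum X ≫ swap12 X X X ≫ k := by
  simpa only [Category.assoc] using cyclicSum_comp_swap23 hX =≫ k

theorem swap23_comp_cyclicSum (hX : (β_ X X).hom ≫ (β_ X X).hom = 𝟙 _) :
    swap23 X X X ≫ cyclicSum X = swap12 X X X ≫ cyclicSum X := by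
  simp [cyclicSum, swap12_comp_swap12_assoc hX, swap23_comp_swap23_assoc hX, swap12_swap23_swap12,
    Preadditive.comp_add]
  abel

end CyclicSum

end SingleObject

/-! ### Supports, and vanishing of composites through mismatched summands -/

section Support

variable {C : Type u} [Category.{v} C] [MonoidalCategory C] {X : C}

/-- A bracket on `X` supported on the summands of `X ⊗ X` and `X` cut out by three endomorphisms. -/
structure BracketSupport (p q r : X ⟶ X) (f : X ⊗ X ⟶ X) : Prop where
  left : p ▷ X ≫ f = f
  right : X ◁ q ≫ f = f
  out : f ≫ r = f

/-- A cobracket on `X` supported on the summands of `X ⊗ X` and `X` cut out by three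
endomorphisms. -/
structure CobracketSupport (p q r : X ⟶ X) (f : X ⟶ X ⊗ X) : Prop where
  left : f ≫ p ▷ X = f
  right : f ≫ X ◁ q = f
  inp : r ≫ f = f

theorem BracketSupport.braiding [BraidedCategory C] {p q r : X ⟶ X} {f : X ⊗ X ⟶ X}
    (h : BracketSupport p q r f) :
    BracketSupport q p r ((β_ X X).hom ≫ f) where
  left := by rw [← Category.assoc, braiding_naturality_left, Category.assoc, h.right]
  right := by rw [← Category.assoc, braiding_naturality_right, Category.assoc, h.left]
  out := by rw [Category.assoc, h.out]

theorem CobracketSupport.braiding [BraidedCategory C] {p q r : X ⟶ X} {f : X ⟶ X ⊗ X}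
    (h : CobracketSupport p q r f) :
    CobracketSupport q p r (f ≫ (β_ X X).hom) where
  left := by rw [Category.assoc, ← braiding_naturality_right, ← Category.assoc, h.right]
  right := by rw [Category.assoc, ← braiding_naturality_left, ← Category.assoc, h.left]
  inp := by rw [← Category.assoc, h.inp]

theorem comp_eq_zero_of_support [Preadditive C]
    {p q r p' q' r' : X ⟶ X} {f : X ⊗ X ⟶ X} {g : X ⟶ X ⊗ X}
    (hf : BracketSupport p q r f) (hg : CobracketSupport p' q' r' g) (h : r ≫ r' = 0) :
    f ≫ g = 0 := by
  rw [← hf.out, ← hg.inp, Category.assoc, reassoc_of% h]; simp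

theorem comp_eq_zero_of_support_assoc [Preadditive C]
    {p q r p' q' r' : X ⟶ X} {f : X ⊗ X ⟶ X} {g : X ⟶ X ⊗ X}
    (hf : BracketSupport p q r f) (hg : CobracketSupport p' q' r' g) (h : r ≫ r' = 0)
    {T : C} (k : _ ⟶ T) :
    f ≫ g ≫ k = 0 := by
  simpa only [Category.assoc, zero_comp] using comp_eq_zero_of_support hf hg h =≫ k

/-- On elements, `x ⊗ y ↦ g (x ⊗ y₁) ⊗ y₂`, where `f y = y₁ ⊗ y₂`. -/
def loop (f : X ⟶ X ⊗ X) (g : X ⊗ X ⟶ X) : X ⊗ X ⟶ X ⊗ X :=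
  X ◁ f ≫ merge12 g X

theorem whiskerLeft_comp_merge12 (f : X ⟶ X ⊗ X) (g : X ⊗ X ⟶ X) :
    X ◁ f ≫ merge12 g X = loop f g := rfl

end Support

section Braided

variable {C : Type u} [Category.{v} C] [MonoidalCategory C] [BraidedCategory C] {X : C}

/-- Naturality of the braiding slides the idle strand past `f`. This brings both bracketings of a
nested product to the form used in the Jacobi identity. -/
theorem whiskerLeft_comp_eq_merge12 (hX : (β_ X X).hom ≫ (β_ X X).hom = 𝟙 _)
    (f g : X ⊗ X ⟶ X) :
    X ◁ f ≫ g = swap12 X X X ≫ swap23 X X X ≫ merge12 f X ≫ (β_ X X).hom ≫ g := by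
  rw [merge12_comp_braiding_assoc, swap23_comp_swap23_assoc hX, swap12_comp_swap12_assoc hX]

theorem whiskerLeft_eq_split12 (hX : (β_ X X).hom ≫ (β_ X X).hom = 𝟙 _)
    (g : X ⟶ X ⊗ X) :
    X ◁ g = (β_ X X).hom ≫ split12 g X ≫ swap23 X X X ≫ swap12 X X X := by
  rw [← braiding_comp_whiskerLeft, reassoc_of% hX]

theorem merge12_braiding_comp {Y W : C} (f : Y ⊗ X ⟶ W) (Z : C) :
    merge12 ((β_ X Y).hom ≫ f) Z = swap12 X Y Z ≫ merge12 f Z :=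
  (swap12_comp_merge12 f Z).symm

theorem split12_comp_braiding {Y W : C} (f : W ⟶ X ⊗ Y) (Z : C) :
    split12 (f ≫ (β_ X Y).hom) Z = split12 f Z ≫ swap12 X Y Z :=
  (split12_comp_swap12 f Z).symm

end Braided

section CyclicSum

variable {C : Type u} [Category.{v} C] [Preadditive C] [MonoidalCategory C] [BraidedCategory C]
  {X : C}

theorem cyclicSum_comp_swap12_swap12 (hX : (β_ X X).hom ≫ (β_ X X).hom = 𝟙 _) {W : C}
    (k : X ⊗ X ⊗ X ⟶ W) : cyclicSum X ≫ swap12 X X X ≫ swap12 X X X ≫ k = cyclicSum X ≫ k := by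
  rw [swap12_comp_swap12_assoc hX]

theorem cyclicSum_comp_swap12_swap23 (hX : (β_ X X).hom ≫ (β_ X X).hom = 𝟙 _) {W : C}
    (k : X ⊗ X ⊗ X ⟶ W) : cyclicSum X ≫ swap12 X X X ≫ swap23 X X X ≫ k = cyclicSum X ≫ k := by
  rw [← cyclicSum_comp_swap23_assoc hX, swap23_comp_swap23_assoc hX]

theorem swap12_swap12_comp_cyclicSum (hX : (β_ X X).hom ≫ (β_ X X).hom = 𝟙 _) :
    swap12 X X X ≫ swap12 X X X ≫ cyclicSum X = cyclicSum X := by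
  rw [swap12_comp_swap12_assoc hX]

theorem swap23_swap12_comp_cyclicSum (hX : (β_ X X).hom ≫ (β_ X X).hom = 𝟙 _) :
    swap23 X X X ≫ swap12 X X X ≫ cyclicSum X = cyclicSum X := by
  rw [← swap23_comp_cyclicSum hX, swap23_comp_swap23_assoc hX]

end CyclicSum

/-! ### Linearity of the strand operations, and further vanishing lemmas -/

section Linear

variable {C : Type u} [Category.{v} C] [Preadditive C] [MonoidalCategory C]
  [MonoidalPreadditive C] {X : C}

theorem whiskerLeft_sub {W Y : C} (Z : C) (f g : W ⟶ Y) : Z ◁ (f - g) = Z ◁ f - Z ◁ g :=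
  (tensorLeft Z).map_sub

theorem whiskerLeft_neg {W Y : C} (Z : C) (f : W ⟶ Y) : Z ◁ (-f) = -Z ◁ f :=
  (tensorLeft Z).map_neg

theorem sub_whiskerRight {W Y : C} (f g : W ⟶ Y) (Z : C) : (f - g) ▷ Z = f ▷ Z - g ▷ Z :=
  (tensorRight Z).map_sub

theorem neg_whiskerRight {W Y : C} (f : W ⟶ Y) (Z : C) : (-f) ▷ Z = -f ▷ Z :=
  (tensorRight Z).map_neg

theorem merge12_add {W X Y : C} (f g : X ⊗ Y ⟶ W) (Z : C) :
    merge12 (f + g) Z = merge12 f Z + merge12 g Z := by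
  simp [merge12, MonoidalPreadditive.add_whiskerRight]

theorem merge12_sub {W X Y : C} (f g : X ⊗ Y ⟶ W) (Z : C) :
    merge12 (f - g) Z = merge12 f Z - merge12 g Z := by
  simp [merge12, sub_whiskerRight]

theorem merge12_neg {W X Y : C} (f : X ⊗ Y ⟶ W) (Z : C) : merge12 (-f) Z = -merge12 f Z := by
  simp [merge12, neg_whiskerRight]

theorem split12_add {W X Y : C} (f g : W ⟶ X ⊗ Y) (Z : C) :
    split12 (f + g) Z = split12 f Z + split12 g Z := by
  simp [split12, MonoidalPreadditive.add_whiskerRight]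

theorem split12_sub {W X Y : C} (f g : W ⟶ X ⊗ Y) (Z : C) :
    split12 (f - g) Z = split12 f Z - split12 g Z := by
  simp [split12, sub_whiskerRight]

theorem merge12_comp_eq_zero {p q r p' q' r' : X ⟶ X} {f g : X ⊗ X ⟶ X}
    (hf : BracketSupport p q r f) (hg : BracketSupport p' q' r' g) (h : r ≫ p' = 0) :
    merge12 f X ≫ g = 0 := by
  have : r ▷ X ≫ p' ▷ X = 0 := by rw [← comp_whiskerRight, h, MonoidalPreadditive.zero_whiskerRight]
  rw [← hf.out, ← hg.left, merge12, comp_whiskerRight]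
  simp [reassoc_of% this]

theorem comp_split12_eq_zero {p q r p' q' r' : X ⟶ X} {f g : X ⟶ X ⊗ X}
    (hf : CobracketSupport p q r f) (hg : CobracketSupport p' q' r' g) (h : p ≫ r' = 0) :
    f ≫ split12 g X = 0 := by
  have : p ▷ X ≫ r' ▷ X = 0 := by rw [← comp_whiskerRight, h, MonoidalPreadditive.zero_whiskerRight]
  rw [← hf.left, ← hg.inp, split12, comp_whiskerRight]
  simp [reassoc_of% this]

theorem comp_split12_eq_zero_assoc {p q r p' q' r' : X ⟶ X} {f g : X ⟶ X ⊗ X}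
    (hf : CobracketSupport p q r f) (hg : CobracketSupport p' q' r' g) (h : p ≫ r' = 0)
    {T : C} (k : _ ⟶ T) :
    f ≫ split12 g X ≫ k = 0 := by
  simpa only [Category.assoc, zero_comp] using comp_split12_eq_zero hf hg h =≫ k

/-- The first leg of `f` is the strand fed into the second argument of `g`, hence the condition on
`p` and `q'`. -/
theorem loop_eq_zero {p q r p' q' r' : X ⟶ X} {f : X ⟶ X ⊗ X} {g : X ⊗ X ⟶ X}
    (hf : CobracketSupport p q r f) (hg : BracketSupport p' q' r' g) (h : p ≫ q' = 0) :
    loop f g = 0 := by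
  have : X ◁ (p ▷ X) ≫ (α_ X X X).inv ≫ (X ◁ q' ≫ g) ▷ X = 0 := by
    rw [comp_whiskerRight, ← associator_inv_naturality_middle_assoc]
    simp [← whiskerLeft_comp_assoc, ← comp_whiskerRight, h]
  rw [loop, merge12, ← hf.left, ← hg.right, whiskerLeft_comp, Category.assoc, this, comp_zero]

theorem loop_add_left (f f' : X ⟶ X ⊗ X) (g : X ⊗ X ⟶ X) :
    loop (f + f') g = loop f g + loop f' g := by
  simp [loop]

theorem loop_sub_left (f f' : X ⟶ X ⊗ X) (g : X ⊗ X ⟶ X) :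
    loop (f - f') g = loop f g - loop f' g := by
  simp [loop, whiskerLeft_sub]

theorem loop_add_right (f : X ⟶ X ⊗ X) (g g' : X ⊗ X ⟶ X) :
    loop f (g + g') = loop f g + loop f g' := by
  simp [loop, merge12_add]

theorem loop_sub_right (f : X ⟶ X ⊗ X) (g g' : X ⊗ X ⟶ X) :
    loop f (g - g') = loop f g - loop f g' := by
  simp [loop, merge12_sub]

theorem loop_neg_left (f : X ⟶ X ⊗ X) (g : X ⊗ X ⟶ X) : loop (-f) g = -loop f g := by
  simp [loop, whiskerLeft_neg]

theorem loop_neg_right (f : X ⟶ X ⊗ X) (g : X ⊗ X ⟶ X) : loop f (-g) = -loop f g := by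
  simp [loop, merge12_neg]

end Linear

/-! ### Normal forms for a cobracket and a bracket joined along one strand -/

section Loop

variable {C : Type u} [Category.{v} C] [MonoidalCategory C] [BraidedCategory C] {X : C}
  (f : X ⟶ X ⊗ X) (g : X ⊗ X ⟶ X)

/-- Such a composite is fixed by four binary choices: which input splits, which leg is used, which
argument it enters, and the order of the outputs. Each choice is an optional braiding, before or
after `loop` or inside one of its arguments. This and the following lemmas give the cases that occur
in the axioms. -/
theorem whiskerLeft_swap23_merge12 :
    X ◁ f ≫ swap23 X X X ≫ merge12 g X = loop (f ≫ (β_ X X).hom) g := by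
  rw [whiskerLeft_comp_swap23_assoc, loop]

theorem whiskerLeft_swap12_merge12 :
    X ◁ f ≫ swap12 X X X ≫ merge12 g X = loop f ((β_ X X).hom ≫ g) := by
  rw [swap12_comp_merge12, loop]

theorem whiskerLeft_swap12_whiskerLeft (hX : (β_ X X).hom ≫ (β_ X X).hom = 𝟙 _) :
    X ◁ f ≫ swap12 X X X ≫ X ◁ g = loop (f ≫ (β_ X X).hom) g ≫ (β_ X X).hom := by
  rw [loop, Category.assoc, merge12_comp_braiding, ← whiskerLeft_comp_swap23_assoc,
    swap23_comp_swap23_assoc hX]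

theorem whiskerLeft_swap12_swap23_swap12_whiskerLeft :
    X ◁ f ≫ swap12 X X X ≫ swap23 X X X ≫ swap12 X X X ≫ X ◁ g =
      loop f ((β_ X X).hom ≫ g) ≫ (β_ X X).hom := by
  rw [loop, Category.assoc, merge12_comp_braiding, whiskerLeft_comp, ← swap23,
    swap12_swap23_swap12_assoc]

theorem split12_eq (hX : (β_ X X).hom ≫ (β_ X X).hom = 𝟙 _) :
    split12 f X = (β_ X X).hom ≫ X ◁ f ≫ swap12 X X X ≫ swap23 X X X := by
  rw [braiding_comp_whiskerLeft_assoc, swap12_comp_swap12_assoc hX, swap23_comp_swap23 hX,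
    Category.comp_id]

theorem split12_whiskerLeft (hX : (β_ X X).hom ≫ (β_ X X).hom = 𝟙 _) :
    split12 f X ≫ X ◁ g =
      (β_ X X).hom ≫ loop (f ≫ (β_ X X).hom) ((β_ X X).hom ≫ g) ≫ (β_ X X).hom := by
  rw [← whiskerLeft_swap12_swap23_swap12_whiskerLeft, ← whiskerLeft_comp_swap23_assoc,
    split12_eq f hX, swap12_swap23_swap12_assoc]
  simp only [Category.assoc, swap23_comp_swap23_assoc hX]

theorem split12_swap23_merge12 (hX : (β_ X X).hom ≫ (β_ X X).hom = 𝟙 _) :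
    split12 f X ≫ swap23 X X X ≫ merge12 g X = (β_ X X).hom ≫ loop f ((β_ X X).hom ≫ g) := by
  rw [split12_eq f hX, ← whiskerLeft_swap12_merge12]
  simp only [Category.assoc, swap23_comp_swap23_assoc hX]

theorem split12_swap12_whiskerLeft (hX : (β_ X X).hom ≫ (β_ X X).hom = 𝟙 _) :
    split12 f X ≫ swap12 X X X ≫ X ◁ g =
      (β_ X X).hom ≫ loop f ((β_ X X).hom ≫ g) ≫ (β_ X X).hom := by
  rw [split12_eq f hX, ← whiskerLeft_swap12_swap23_swap12_whiskerLeft]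
  simp only [Category.assoc]

theorem split12_swap23_whiskerLeft (hX : (β_ X X).hom ≫ (β_ X X).hom = 𝟙 _) :
    split12 f X ≫ swap23 X X X ≫ X ◁ g =
      (β_ X X).hom ≫ loop (f ≫ (β_ X X).hom) g ≫ (β_ X X).hom := by
  rw [split12_eq f hX, ← whiskerLeft_swap12_whiskerLeft _ _ hX]
  simp only [Category.assoc, swap23_comp_swap23_assoc hX]

theorem split12_swap23_swap12_swap23_merge12 (hX : (β_ X X).hom ≫ (β_ X X).hom = 𝟙 _) :
    split12 f X ≫ swap23 X X X ≫ swap12 X X X ≫ swap23 X X X ≫ merge12 g X =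
      (β_ X X).hom ≫ loop (f ≫ (β_ X X).hom) g := by
  rw [split12_eq f hX, ← whiskerLeft_swap23_merge12]
  simp only [Category.assoc, swap23_comp_swap23_assoc hX, swap12_comp_swap12_assoc hX]

end Loop

theorem IsSymmetricOn.braiding_comp_braiding {C : Type u} [Category.{v} C] [MonoidalCategory C]
    [BraidedCategory C] {X : C} (h : IsSymmetricOn ({X} : Set C)) :
    (β_ X X).hom ≫ (β_ X X).hom = 𝟙 _ := by
  nth_rw 2 [h X rfl X rfl]; simp

/-! ### Lie algebra and Lie coalgebra axioms for the total structures -/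

section SingleObjectBialgebra

variable {C : Type u} [Category.{v} C] [Preadditive C] [MonoidalCategory C]
  [BraidedCategory C] {X : C}

/-- The sum of two brackets and of the antisymmetrizations of two actions, all on one object. -/
def totalBracket (brA brH α β : X ⊗ X ⟶ X) : X ⊗ X ⟶ X :=
  brA + brH + (α - (β_ X X).hom ≫ α) + (β - (β_ X X).hom ≫ β)

/-- The sum of two cobrackets and of the antisymmetrizations of two coactions, all on one
object. -/
def totalCobracket (δA δH φ ψ : X ⟶ X ⊗ X) : X ⟶ X ⊗ X :=
  δA + δH + (φ - φ ≫ (β_ X X).hom) + (ψ - ψ ≫ (β_ X X).hom)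

/-- Structure morphisms on `X` that are supported on the summands cut out by `e` and `f` as those
of `A` and `H` are in `A ⊞ H`. -/
structure BracketsSupport (e f : X ⟶ X) (brA brH α β : X ⊗ X ⟶ X) : Prop where
  brA : BracketSupport e e e brA
  brH : BracketSupport f f f brH
  α : BracketSupport f e e α
  β : BracketSupport f e f β

/-- The dual of `BracketsSupport`. -/
structure CobracketsSupport (e f : X ⟶ X) (δA δH φ ψ : X ⟶ X ⊗ X) : Prop where
  δA : CobracketSupport e e e δA
  δH : CobracketSupport f f f δH
  φ : CobracketSupport f e e φ
  ψ : CobracketSupport f e f ψ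

theorem totalBracket_antisymm {brA brH α β : X ⊗ X ⟶ X}
    (hA : IsLieAlgebra X brA) (hH : IsLieAlgebra X brH) :
    totalBracket brA brH α β + (β_ X X).hom ≫ totalBracket brA brH α β = 0 := by
  have hX := hA.symmetric.braiding_comp_braiding
  have h1 := eq_neg_of_add_eq_zero_right hA.antisymm
  have h2 := eq_neg_of_add_eq_zero_right hH.antisymm
  simp only [totalBracket, Preadditive.comp_add, Preadditive.comp_sub, h1, h2, reassoc_of% hX]
  abel

theorem totalCobracket_coantisymm {δA δH φ ψ : X ⟶ X ⊗ X}
    (hA : IsLieCoalgebra X δA) (hH : IsLieCoalgebra X δH) :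
    totalCobracket δA δH φ ψ + totalCobracket δA δH φ ψ ≫ (β_ X X).hom = 0 := by
  have hX := hA.symmetric.braiding_comp_braiding
  have h1 := eq_neg_of_add_eq_zero_right hA.coantisymm
  have h2 := eq_neg_of_add_eq_zero_right hH.coantisymm
  simp only [totalCobracket, Preadditive.add_comp, Preadditive.sub_comp, h1, h2, Category.assoc,
    hX, Category.comp_id]
  abel

variable [MonoidalPreadditive C]

/-- Of the 36 nested terms, support leaves 18. Two vanish by the Jacobi identities of `brA` and
`brH`; four are a bracket followed by an action, and M1, M2 and the module axioms cancel them
against the twelve that begin with an action. -/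
theorem IsMatchedPairLieAlgebras.isLieAlgebra_totalBracket {e f : X ⟶ X}
    {brA brH α β : X ⊗ X ⟶ X} (h : IsMatchedPairLieAlgebras brA brH α β)
    (hef : e ≫ f = 0) (hfe : f ≫ e = 0) (hs : BracketsSupport e f brA brH α β) :
    IsLieAlgebra X (totalBracket brA brH α β) := by
  have hX := h.lieAlgebra_left.symmetric.braiding_comp_braiding
  refine ⟨h.lieAlgebra_left.symmetric,
    totalBracket_antisymm h.lieAlgebra_left h.lieAlgebra_right, ?_⟩
  have lm := h.leftModule
  have rm := h.rightModule
  have m1 := h.m1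
  have m2 := h.m2
  unfold IsLeftModule at lm
  unfold IsRightModule at rm
  have ja := h.lieAlgebra_left.jacobi
  have jh := h.lieAlgebra_right.jacobi
  rw [← cyclicSum] at ja jh ⊢
  replace lm := cyclicSum X ≫= lm
  replace rm := cyclicSum X ≫= rm
  replace m1 := cyclicSum X ≫= m1
  replace m2 := cyclicSum X ≫= m2
  have aH := eq_neg_of_add_eq_zero_right h.lieAlgebra_left.antisymm
  have hH := eq_neg_of_add_eq_zero_right h.lieAlgebra_right.antisymm
  -- The left-hand sides become the cyclic sums of a bracket followed by an action, so the four
  -- relations serve as rewrite rules for the expanded Jacobi identity.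
  simp only [whiskerLeft_comp_eq_merge12 hX, Preadditive.comp_add, Preadditive.comp_sub,
    cyclicSum_comp_swap12_swap12 hX, cyclicSum_comp_swap12_swap23 hX,
    cyclicSum_comp_swap23_assoc hX, aH, hH, Preadditive.comp_neg]
    at lm rm m1 m2
  simp only [totalBracket, Preadditive.comp_add, Preadditive.comp_sub, merge12_add, merge12_sub,
    Preadditive.add_comp, Preadditive.sub_comp, merge12_braiding_comp, Category.assoc, ja, jh,
    merge12_comp_eq_zero hs.brA hs.brH hef, merge12_comp_eq_zero hs.brA hs.α hef,
    merge12_comp_eq_zero hs.brA hs.β hef,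
    merge12_comp_eq_zero hs.brH hs.brA hfe, merge12_comp_eq_zero hs.brH hs.α.braiding hfe,
    merge12_comp_eq_zero hs.brH hs.β.braiding hfe,
    merge12_comp_eq_zero hs.α hs.brH hef, merge12_comp_eq_zero hs.α hs.α hef,
    merge12_comp_eq_zero hs.α hs.β hef,
    merge12_comp_eq_zero hs.β hs.brA hfe, merge12_comp_eq_zero hs.β hs.α.braiding hfe,
    merge12_comp_eq_zero hs.β hs.β.braiding hfe, comp_zero, lm, rm, m1, m2]
  abel

theorem IsMatchedPairLieCoalgebras.isLieCoalgebra_totalCobracket {e f : X ⟶ X}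
    {δA δH φ ψ : X ⟶ X ⊗ X} (h : IsMatchedPairLieCoalgebras δA δH φ ψ)
    (hef : e ≫ f = 0) (hfe : f ≫ e = 0) (hs : CobracketsSupport e f δA δH φ ψ) :
    IsLieCoalgebra X (totalCobracket δA δH φ ψ) := by
  have hX := h.lieCoalgebra_left.symmetric.braiding_comp_braiding
  refine ⟨h.lieCoalgebra_left.symmetric,
    totalCobracket_coantisymm h.lieCoalgebra_left h.lieCoalgebra_right, ?_⟩
  have lm := h.leftComodule
  have rm := h.rightComodule
  have m1 := h.cm1
  have m2 := h.cm2
  unfold IsLeftComodule at lm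
  unfold IsRightComodule at rm
  have ja := h.lieCoalgebra_left.cojacobi
  have jh := h.lieCoalgebra_right.cojacobi
  rw [← cyclicSum] at ja jh ⊢
  replace lm := lm =≫ cyclicSum X
  replace rm := rm =≫ cyclicSum X
  replace m1 := m1 =≫ cyclicSum X
  replace m2 := m2 =≫ cyclicSum X
  have aH := eq_neg_of_add_eq_zero_right h.lieCoalgebra_left.coantisymm
  have hH := eq_neg_of_add_eq_zero_right h.lieCoalgebra_right.coantisymm
  simp only [whiskerLeft_eq_split12 hX, Preadditive.add_comp, Preadditive.sub_comp,
    Category.assoc, swap12_swap12_comp_cyclicSum hX, swap23_swap12_comp_cyclicSum hX,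
    swap23_comp_cyclicSum hX, reassoc_of% aH, reassoc_of% hH,
    Preadditive.neg_comp] at lm rm m1 m2
  simp only [totalCobracket, Preadditive.comp_add, Preadditive.comp_sub, split12_add, split12_sub,
    Preadditive.add_comp, Preadditive.sub_comp, split12_comp_braiding, Category.assoc, ja, jh,
    comp_split12_eq_zero_assoc hs.δA hs.δH hef,
    comp_split12_eq_zero_assoc hs.δA hs.ψ hef,
    comp_split12_eq_zero_assoc hs.δH hs.δA hfe,
    comp_split12_eq_zero_assoc hs.δH hs.φ hfe,
    comp_split12_eq_zero_assoc hs.φ hs.δA hfe,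
    comp_split12_eq_zero_assoc hs.φ hs.φ hfe,
    -- A braided coaction is itself a composite, so its vanishing lemma is reassociated to match the
    -- right-nested terms.
    (Category.assoc _ _ _).symm.trans (comp_split12_eq_zero_assoc hs.φ.braiding hs.δH hef _),
    (Category.assoc _ _ _).symm.trans (comp_split12_eq_zero_assoc hs.φ.braiding hs.ψ hef _),
    comp_split12_eq_zero_assoc hs.ψ hs.δA hfe,
    comp_split12_eq_zero_assoc hs.ψ hs.φ hfe,
    (Category.assoc _ _ _).symm.trans (comp_split12_eq_zero_assoc hs.ψ.braiding hs.δH hef _),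
    (Category.assoc _ _ _).symm.trans (comp_split12_eq_zero_assoc hs.ψ.braiding hs.ψ hef _),
    lm, rm, m1, m2]
  abel

end SingleObjectBialgebra

/-! ### Compatibility of the total bracket and cobracket -/

section SingleObjectCompat

variable {C : Type u} [Category.{v} C] [Preadditive C] [MonoidalCategory C]
  [BraidedCategory C] {X : C}

/-- Only products whose intermediate strand has matching support survive. They are grouped by the
axiom that evaluates them; `α ≫ φ` and `β ≫ ψ` stay together because B5 controls only their sum. -/
theorem totalBracket_comp_totalCobracket {e f : X ⟶ X} {brA brH α β : X ⊗ X ⟶ X}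
    {δA δH φ ψ : X ⟶ X ⊗ X} (hef : e ≫ f = 0) (hfe : f ≫ e = 0)
    (ht : BracketsSupport e f brA brH α β) (hs : CobracketsSupport e f δA δH φ ψ) :
    totalBracket brA brH α β ≫ totalCobracket δA δH φ ψ =
      brA ≫ δA + brH ≫ δH + (brA ≫ φ - (brA ≫ φ) ≫ (β_ X X).hom)
      + (brH ≫ ψ - (brH ≫ ψ) ≫ (β_ X X).hom)
      + (α ≫ δA - (β_ X X).hom ≫ α ≫ δA) + (β ≫ δH - (β_ X X).hom ≫ β ≫ δH)
      + ((α ≫ φ + β ≫ ψ) - (α ≫ φ + β ≫ ψ) ≫ (β_ X X).hom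
        - (β_ X X).hom ≫ (α ≫ φ + β ≫ ψ) + (β_ X X).hom ≫ (α ≫ φ + β ≫ ψ) ≫ (β_ X X).hom) := by
  simp only [totalBracket, totalCobracket, Preadditive.comp_add, Preadditive.comp_sub,
    Preadditive.add_comp, Preadditive.sub_comp, Category.assoc,
    comp_eq_zero_of_support ht.brA hs.δH hef,
    comp_eq_zero_of_support_assoc ht.brA hs.ψ hef,
    comp_eq_zero_of_support ht.brA hs.ψ hef,
    comp_eq_zero_of_support ht.brH hs.δA hfe,
    comp_eq_zero_of_support_assoc ht.brH hs.φ hfe,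
    comp_eq_zero_of_support ht.brH hs.φ hfe,
    comp_eq_zero_of_support ht.α hs.δH hef,
    comp_eq_zero_of_support_assoc ht.α hs.ψ hef,
    comp_eq_zero_of_support ht.α hs.ψ hef,
    comp_eq_zero_of_support ht.β hs.δA hfe,
    comp_eq_zero_of_support_assoc ht.β hs.φ hfe,
    comp_eq_zero_of_support ht.β hs.φ hfe,
    comp_zero]
  abel

variable [MonoidalPreadditive C]

/-- Anti-co-symmetry makes the second summand of `cocycleRHS` the first one braided on the outputs,
with opposite sign. The result is `loop δ br` antisymmetrized on inputs and outputs. -/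
theorem cocycleRHS_eq_loop (hX : (β_ X X).hom ≫ (β_ X X).hom = 𝟙 _) {br : X ⊗ X ⟶ X}
    {δ : X ⟶ X ⊗ X} (hδ : δ + δ ≫ (β_ X X).hom = 0) :
    cocycleRHS br δ = loop δ br - loop δ br ≫ (β_ X X).hom - (β_ X X).hom ≫ loop δ br
      + (β_ X X).hom ≫ loop δ br ≫ (β_ X X).hom := by
  simp only [cocycleRHS, whiskerLeft_comp_merge12, whiskerLeft_swap12_whiskerLeft _ _ hX,
    eq_neg_of_add_eq_zero_right hδ, loop_neg_left, Preadditive.neg_comp, Preadditive.comp_neg]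
  abel

theorem IsDoubleMatchedPair.compat {e f : X ⟶ X} {brA brH α β : X ⊗ X ⟶ X}
    {δA δH φ ψ : X ⟶ X ⊗ X} (h : IsDoubleMatchedPair brA brH δA δH α β φ ψ)
    (hef : e ≫ f = 0) (hfe : f ≫ e = 0)
    (ht : BracketsSupport e f brA brH α β) (hs : CobracketsSupport e f δA δH φ ψ) :
    totalBracket brA brH α β ≫ totalCobracket δA δH φ ψ =
      cocycleRHS (totalBracket brA brH α β) (totalCobracket δA δH φ ψ) := by
  have hX := h.lieAlgebra_left.symmetric.braiding_comp_braiding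
  have hA := h.lieCoalgebra_left.coantisymm
  have hH := h.lieCoalgebra_right.coantisymm
  have hA' := eq_neg_of_add_eq_zero_right hA
  have hH' := eq_neg_of_add_eq_zero_right hH
  have bA := eq_neg_of_add_eq_zero_right h.lieAlgebra_left.antisymm
  have bH := eq_neg_of_add_eq_zero_right h.lieAlgebra_right.antisymm
  rw [totalBracket_comp_totalCobracket hef hfe ht hs, h.slb_left, h.slb_right, h.b1, h.b2, h.b3,
    h.b4, h.b5, cocycleRHS_eq_loop hX hA, cocycleRHS_eq_loop hX hH, cocycleRHS_eq_loop hX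
    (totalCobracket_coantisymm h.lieCoalgebra_left h.lieCoalgebra_right)]
  simp only [leftInfBraiding, rightInfBraiding, whiskerLeft_comp_merge12,
    whiskerLeft_swap23_merge12, whiskerLeft_swap12_merge12, whiskerLeft_swap12_whiskerLeft _ _ hX,
    whiskerLeft_swap12_swap23_swap12_whiskerLeft, split12_whiskerLeft _ _ hX,
    split12_swap23_merge12 _ _ hX, split12_swap12_whiskerLeft _ _ hX,
    split12_swap23_whiskerLeft _ _ hX, split12_swap23_swap12_swap23_merge12 _ _ hX,
    hA', hH', bA, bH, reassoc_of% hX, hX, Category.comp_id,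
    loop_neg_left, loop_neg_right,
    Preadditive.comp_add, Preadditive.comp_sub, Preadditive.add_comp, Preadditive.sub_comp,
    Preadditive.comp_neg, Preadditive.neg_comp, Category.assoc]
  -- Bilinearity gives 36 loops; for each of the six cobracket terms, three of the six bracket terms
  -- have the wrong support in their second argument.
  simp only [totalBracket, totalCobracket, loop_add_left, loop_add_right, loop_sub_left,
    loop_sub_right,
    loop_eq_zero hs.δA ht.brH hef,
    loop_eq_zero hs.δA ht.α.braiding hef,
    loop_eq_zero hs.δA ht.β.braiding hef,
    loop_eq_zero hs.δH ht.brA hfe,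
    loop_eq_zero hs.δH ht.α hfe,
    loop_eq_zero hs.δH ht.β hfe,
    loop_eq_zero hs.φ ht.brA hfe,
    loop_eq_zero hs.φ ht.α hfe,
    loop_eq_zero hs.φ ht.β hfe,
    loop_eq_zero hs.φ.braiding ht.brH hef,
    loop_eq_zero hs.φ.braiding ht.α.braiding hef,
    loop_eq_zero hs.φ.braiding ht.β.braiding hef,
    loop_eq_zero hs.ψ ht.brA hfe,
    loop_eq_zero hs.ψ ht.α hfe,
    loop_eq_zero hs.ψ ht.β hfe,
    loop_eq_zero hs.ψ.braiding ht.brH hef,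
    loop_eq_zero hs.ψ.braiding ht.α.braiding hef,
    loop_eq_zero hs.ψ.braiding ht.β.braiding hef,
    Preadditive.comp_add, Preadditive.comp_sub, Preadditive.add_comp, Preadditive.sub_comp,
    comp_zero, zero_comp]
  abel

end SingleObjectCompat

/-! ### Moving inclusions through strand diagrams -/

section Push

variable {C : Type u} [Category.{v} C] [MonoidalCategory C]

@[simp]
-- The simp lemmas of this section carry tensor products of inclusions to the right through
-- structure maps and braidings. Where an inclusion meets a projection the composite is an identity
-- or zero; the surviving structure map is then pulled out to the left and the inclusions move on.
theorem tensorHom_comp_whiskerLeft {Y Y' V V' W : C} (i : Y ⟶ Y') (g : V ⟶ V') (f : V' ⟶ W) :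
    (i ⊗ₘ g) ≫ Y' ◁ f = i ⊗ₘ (g ≫ f) := by
  simp [MonoidalCategory.tensorHom_def]

@[simp]
theorem tensorHom_comp_whiskerLeft_assoc {Y Y' V V' W : C} (i : Y ⟶ Y') (g : V ⟶ V') (f : V' ⟶ W)
    {T : C} (t : _ ⟶ T) :
    (i ⊗ₘ g) ≫ Y' ◁ f ≫ t = (i ⊗ₘ (g ≫ f)) ≫ t := by
  simpa only [Category.assoc] using tensorHom_comp_whiskerLeft i g f =≫ t

@[simp]
theorem tensorHom_comp_right {Y Y' V W Z : C} (i : Y ⟶ Y') (f : V ⟶ W) (l : W ⟶ Z) :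
    i ⊗ₘ (f ≫ l) = Y ◁ f ≫ (i ⊗ₘ l) := by
  simp [tensorHom_def']

@[simp]
theorem tensorHom_comp_merge12 {U V Z U' V' Z' W : C} (i : U ⟶ U') (j : V ⟶ V') (k : Z ⟶ Z')
    (f : U' ⊗ V' ⟶ W) :
    (i ⊗ₘ (j ⊗ₘ k)) ≫ merge12 f Z' = (α_ U V Z).inv ≫ (((i ⊗ₘ j) ≫ f) ⊗ₘ k) := by
  rw [merge12, associator_inv_naturality_assoc, ← tensorHom_id, tensorHom_comp_tensorHom,
    Category.comp_id]

@[simp]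
theorem tensorHom_comp_merge12_assoc {U V Z U' V' Z' W : C} (i : U ⟶ U') (j : V ⟶ V') (k : Z ⟶ Z')
    (f : U' ⊗ V' ⟶ W) {T : C} (t : _ ⟶ T) :
    (i ⊗ₘ (j ⊗ₘ k)) ≫ merge12 f Z' ≫ t = (α_ U V Z).inv ≫ (((i ⊗ₘ j) ≫ f) ⊗ₘ k) ≫ t := by
  simpa only [Category.assoc] using tensorHom_comp_merge12 i j k f =≫ t

@[simp]
theorem associator_inv_comp_tensorHom {U V Z W W' Z' : C} (f : U ⊗ V ⟶ W) (l : W ⟶ W')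
    (k : Z ⟶ Z') :
    (α_ U V Z).inv ≫ ((f ≫ l) ⊗ₘ k) = merge12 f Z ≫ (l ⊗ₘ k) := by
  simp [merge12, MonoidalCategory.tensorHom_def]

@[simp]
theorem tensorHom_comp_split12 {W W' Z Z' U V : C} (i : W ⟶ W') (k : Z ⟶ Z') (f : W' ⟶ U ⊗ V) :
    (i ⊗ₘ k) ≫ split12 f Z' = ((i ≫ f) ⊗ₘ k) ≫ (α_ U V Z').hom := by
  rw [split12, ← tensorHom_id, tensorHom_comp_tensorHom_assoc, Category.comp_id]

@[simp]
theorem tensorHom_comp_split12_assoc {W W' Z Z' U V : C} (i : W ⟶ W') (k : Z ⟶ Z') (f : W' ⟶ U ⊗ V)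
    {T : C} (t : _ ⟶ T) :
    (i ⊗ₘ k) ≫ split12 f Z' ≫ t = ((i ≫ f) ⊗ₘ k) ≫ (α_ U V Z').hom ≫ t := by
  simpa only [Category.assoc] using tensorHom_comp_split12 i k f =≫ t

@[simp]
theorem tensorHom_comp_associator {W U V Z U' V' Z' : C} (f : W ⟶ U ⊗ V) (i : U ⟶ U')
    (j : V ⟶ V') (k : Z ⟶ Z') :
    ((f ≫ (i ⊗ₘ j)) ⊗ₘ k) ≫ (α_ U' V' Z').hom = split12 f Z ≫ (i ⊗ₘ (j ⊗ₘ k)) := by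
  rw [split12, Category.assoc, ← associator_naturality]
  simp [MonoidalCategory.tensorHom_def]

@[simp]
theorem tensorHom_comp_associator_assoc {W U V Z U' V' Z' : C} (f : W ⟶ U ⊗ V) (i : U ⟶ U')
    (j : V ⟶ V') (k : Z ⟶ Z') {T : C} (t : _ ⟶ T) :
    ((f ≫ (i ⊗ₘ j)) ⊗ₘ k) ≫ (α_ U' V' Z').hom ≫ t = split12 f Z ≫ (i ⊗ₘ (j ⊗ₘ k)) ≫ t := by
  simpa only [Category.assoc] using tensorHom_comp_associator f i j k =≫ t

@[simp]
theorem associator_inv_comp_whiskerRight_assoc {X Y W : C} (f : X ⊗ Y ⟶ W) (Z : C) {T : C}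
    (t : _ ⟶ T) : (α_ X Y Z).inv ≫ f ▷ Z ≫ t = merge12 f Z ≫ t := by
  rw [merge12, Category.assoc]

variable [BraidedCategory C]

@[simp]
theorem tensorHom_comp_swap12 {U V Z U' V' Z' : C} (i : U ⟶ U') (j : V ⟶ V') (k : Z ⟶ Z') :
    (i ⊗ₘ (j ⊗ₘ k)) ≫ swap12 U' V' Z' = swap12 U V Z ≫ (j ⊗ₘ (i ⊗ₘ k)) := by
  rw [swap12, associator_inv_naturality_assoc, swap12, Category.assoc, Category.assoc,
    ← associator_naturality, ← tensorHom_id, ← tensorHom_id, tensorHom_comp_tensorHom_assoc,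
    tensorHom_comp_tensorHom_assoc, braiding_naturality, Category.comp_id, Category.id_comp]

@[simp]
theorem tensorHom_comp_swap12_assoc {U V Z U' V' Z' : C} (i : U ⟶ U') (j : V ⟶ V') (k : Z ⟶ Z')
    {T : C} (t : _ ⟶ T) :
    (i ⊗ₘ (j ⊗ₘ k)) ≫ swap12 U' V' Z' ≫ t = swap12 U V Z ≫ (j ⊗ₘ (i ⊗ₘ k)) ≫ t := by
  simpa only [Category.assoc] using tensorHom_comp_swap12 i j k =≫ t

@[simp]
theorem tensorHom_comp_swap23 {U V Z U' V' Z' : C} (i : U ⟶ U') (j : V ⟶ V') (k : Z ⟶ Z') :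
    (i ⊗ₘ (j ⊗ₘ k)) ≫ swap23 U' V' Z' = swap23 U V Z ≫ (i ⊗ₘ (k ⊗ₘ j)) := by
  rw [swap23, tensorHom_comp_whiskerLeft, braiding_naturality, tensorHom_comp_right, swap23]

@[simp]
theorem tensorHom_comp_swap23_assoc {U V Z U' V' Z' : C} (i : U ⟶ U') (j : V ⟶ V') (k : Z ⟶ Z')
    {T : C} (t : _ ⟶ T) :
    (i ⊗ₘ (j ⊗ₘ k)) ≫ swap23 U' V' Z' ≫ t = swap23 U V Z ≫ (i ⊗ₘ (k ⊗ₘ j)) ≫ t := by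
  simpa only [Category.assoc] using tensorHom_comp_swap23 i j k =≫ t

end Push

/-! ### Morphisms out of tensor powers of a biproduct -/

section Additive

variable {C : Type u} [Category.{v} C] [Preadditive C] [HasBinaryBiproducts C] {A H : C}

/-- An additive functor preserves the decomposition of the identity as `biprod.fst ≫ biprod.inl +
biprod.snd ≫ biprod.inr`. -/
theorem map_biprod_hom_ext (F : C ⥤ C) [F.Additive] {W : C} {f g : F.obj (A ⊞ H) ⟶ W}
    (h₁ : F.map biprod.inl ≫ f = F.map biprod.inl ≫ g)
    (h₂ : F.map biprod.inr ≫ f = F.map biprod.inr ≫ g) : f = g := by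
  have : F.map (biprod.fst ≫ biprod.inl + biprod.snd ≫ biprod.inr : A ⊞ H ⟶ A ⊞ H) = 𝟙 _ := by
    rw [biprod.total, F.map_id]
  rw [← Category.id_comp f, ← Category.id_comp g, ← this]
  simp only [F.map_add, F.map_comp, Preadditive.add_comp, Category.assoc, h₁, h₂]

end Additive

section Biproduct

variable {C : Type u} [Category.{v} C] [Preadditive C] [MonoidalCategory C]
  [MonoidalPreadditive C] [HasBinaryBiproducts C] {A H : C}

theorem biprod_tensor_biprod_hom_ext {W : C} {f g : (A ⊞ H) ⊗ (A ⊞ H) ⟶ W}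
    (h₁₁ : (biprod.inl ⊗ₘ biprod.inl) ≫ f = (biprod.inl ⊗ₘ biprod.inl) ≫ g)
    (h₁₂ : (biprod.inl ⊗ₘ biprod.inr) ≫ f = (biprod.inl ⊗ₘ biprod.inr) ≫ g)
    (h₂₁ : (biprod.inr ⊗ₘ biprod.inl) ≫ f = (biprod.inr ⊗ₘ biprod.inl) ≫ g)
    (h₂₂ : (biprod.inr ⊗ₘ biprod.inr) ≫ f = (biprod.inr ⊗ₘ biprod.inr) ≫ g) : f = g := by
  apply map_biprod_hom_ext (tensorRight _) <;> apply map_biprod_hom_ext (tensorLeft _) <;>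
    · simp [tensorHom_def'] at *
      assumption

theorem biprod_tensor_biprod_tensor_biprod_hom_ext {W : C}
    {f g : (A ⊞ H) ⊗ (A ⊞ H) ⊗ (A ⊞ H) ⟶ W}
    (h₁₁₁ : (biprod.inl ⊗ₘ (biprod.inl ⊗ₘ biprod.inl)) ≫ f =
      (biprod.inl ⊗ₘ (biprod.inl ⊗ₘ biprod.inl)) ≫ g)
    (h₁₁₂ : (biprod.inl ⊗ₘ (biprod.inl ⊗ₘ biprod.inr)) ≫ f =
      (biprod.inl ⊗ₘ (biprod.inl ⊗ₘ biprod.inr)) ≫ g)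
    (h₁₂₁ : (biprod.inl ⊗ₘ (biprod.inr ⊗ₘ biprod.inl)) ≫ f =
      (biprod.inl ⊗ₘ (biprod.inr ⊗ₘ biprod.inl)) ≫ g)
    (h₁₂₂ : (biprod.inl ⊗ₘ (biprod.inr ⊗ₘ biprod.inr)) ≫ f =
      (biprod.inl ⊗ₘ (biprod.inr ⊗ₘ biprod.inr)) ≫ g)
    (h₂₁₁ : (biprod.inr ⊗ₘ (biprod.inl ⊗ₘ biprod.inl)) ≫ f =
      (biprod.inr ⊗ₘ (biprod.inl ⊗ₘ biprod.inl)) ≫ g)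
    (h₂₁₂ : (biprod.inr ⊗ₘ (biprod.inl ⊗ₘ biprod.inr)) ≫ f =
      (biprod.inr ⊗ₘ (biprod.inl ⊗ₘ biprod.inr)) ≫ g)
    (h₂₂₁ : (biprod.inr ⊗ₘ (biprod.inr ⊗ₘ biprod.inl)) ≫ f =
      (biprod.inr ⊗ₘ (biprod.inr ⊗ₘ biprod.inl)) ≫ g)
    (h₂₂₂ : (biprod.inr ⊗ₘ (biprod.inr ⊗ₘ biprod.inr)) ≫ f =
      (biprod.inr ⊗ₘ (biprod.inr ⊗ₘ biprod.inr)) ≫ g) : f = g := by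
  -- Each functor inserts the biproduct into one tensor slot: the first, the middle and the last in
  -- turn.
  apply map_biprod_hom_ext (tensorRight _) <;>
    apply map_biprod_hom_ext (tensorRight _ ⋙ tensorLeft _) <;>
    apply map_biprod_hom_ext (tensorLeft _ ⋙ tensorLeft _) <;>
    · simp [tensorHom_def'] at *
      assumption

end Biproduct

/-! ### Extending structure maps by zero to the biproduct -/

section Extend

variable {C : Type u} [Category.{v} C] [MonoidalCategory C]

/-- The bracket on `X` obtained from `f : P ⊗ Q ⟶ R` by projecting the arguments and including the
value. -/
def extendBracket {X P Q R : C} (p : X ⟶ P) (q : X ⟶ Q) (i : R ⟶ X) (f : P ⊗ Q ⟶ R) :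
    X ⊗ X ⟶ X :=
  (p ⊗ₘ q) ≫ f ≫ i

/-- The dual of `extendBracket`. -/
def extendCobracket {X P Q R : C} (i : P ⟶ X) (j : Q ⟶ X) (p : X ⟶ R) (f : R ⟶ P ⊗ Q) :
    X ⟶ X ⊗ X :=
  p ≫ f ≫ (i ⊗ₘ j)

@[simp]
theorem tensorHom_comp_extendBracket {X P Q R Y Z : C} (p : X ⟶ P) (q : X ⟶ Q) (i : R ⟶ X)
    (f : P ⊗ Q ⟶ R) (j : Y ⟶ X) (k : Z ⟶ X) :
    (j ⊗ₘ k) ≫ extendBracket p q i f = ((j ≫ p) ⊗ₘ (k ≫ q)) ≫ f ≫ i := by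
  rw [extendBracket, tensorHom_comp_tensorHom_assoc]

@[simp]
theorem tensorHom_comp_extendBracket_assoc {X P Q R Y Z : C} (p : X ⟶ P) (q : X ⟶ Q) (i : R ⟶ X)
    (f : P ⊗ Q ⟶ R) (j : Y ⟶ X) (k : Z ⟶ X) {T : C} (t : _ ⟶ T) :
    (j ⊗ₘ k) ≫ extendBracket p q i f ≫ t = ((j ≫ p) ⊗ₘ (k ≫ q)) ≫ f ≫ i ≫ t := by
  simpa only [Category.assoc] using tensorHom_comp_extendBracket p q i f j k =≫ t

@[simp]
theorem comp_extendCobracket {X P Q R Y : C} (i : P ⟶ X) (j : Q ⟶ X) (p : X ⟶ R)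
    (f : R ⟶ P ⊗ Q) (k : Y ⟶ X) :
    k ≫ extendCobracket i j p f = (k ≫ p) ≫ f ≫ (i ⊗ₘ j) := by
  rw [extendCobracket, Category.assoc]

@[simp]
theorem comp_extendCobracket_assoc {X P Q R Y : C} (i : P ⟶ X) (j : Q ⟶ X) (p : X ⟶ R)
    (f : R ⟶ P ⊗ Q) (k : Y ⟶ X) {T : C} (t : _ ⟶ T) :
    k ≫ extendCobracket i j p f ≫ t = (k ≫ p) ≫ f ≫ (i ⊗ₘ j) ≫ t := by
  simpa only [Category.assoc] using comp_extendCobracket i j p f k =≫ t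

theorem bracketSupport_extendBracket {X P Q R : C} {p : X ⟶ P} {q : X ⟶ Q} {i : R ⟶ X}
    {p' : P ⟶ X} {q' : Q ⟶ X} {r : X ⟶ R} (hp : p' ≫ p = 𝟙 P) (hq : q' ≫ q = 𝟙 Q)
    (hr : i ≫ r = 𝟙 R) (f : P ⊗ Q ⟶ R) :
    BracketSupport (p ≫ p') (q ≫ q') (r ≫ i) (extendBracket p q i f) where
  left := by
    rw [← tensorHom_id, tensorHom_comp_extendBracket, Category.assoc, hp, Category.comp_id,
      Category.id_comp, extendBracket]
  right := by
    rw [← id_tensorHom, tensorHom_comp_extendBracket, Category.assoc, hq, Category.comp_id,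
      Category.id_comp, extendBracket]
  out := by simp [extendBracket, reassoc_of% hr]

theorem cobracketSupport_extendCobracket {X P Q R : C} {i : P ⟶ X} {j : Q ⟶ X} {p : X ⟶ R}
    {i' : X ⟶ P} {j' : X ⟶ Q} {r : R ⟶ X} (hi : i ≫ i' = 𝟙 P) (hj : j ≫ j' = 𝟙 Q)
    (hr : r ≫ p = 𝟙 R) (f : R ⟶ P ⊗ Q) :
    CobracketSupport (i' ≫ i) (j' ≫ j) (p ≫ r) (extendCobracket i j p f) where
  left := by
    rw [← tensorHom_id, extendCobracket, Category.assoc, Category.assoc, tensorHom_comp_tensorHom,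
      reassoc_of% hi, Category.comp_id]
  right := by
    rw [← id_tensorHom, extendCobracket, Category.assoc, Category.assoc, tensorHom_comp_tensorHom,
      reassoc_of% hj, Category.comp_id]
  inp := by simp [extendCobracket, reassoc_of% hr]

end Extend

section Biprod

variable {C : Type u} [Category.{v} C] [Preadditive C] [HasBinaryBiproducts C] [MonoidalCategory C]
  {A H : C} (brA : A ⊗ A ⟶ A) (brH : H ⊗ H ⟶ H) (δA : A ⟶ A ⊗ A)
  (δH : H ⟶ H ⊗ H) (α : H ⊗ A ⟶ A) (β : H ⊗ A ⟶ H) (φ : A ⟶ H ⊗ A) (ψ : H ⟶ H ⊗ A)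

theorem bracketsSupport_biprod :
    BracketsSupport (X := A ⊞ H) (biprod.fst ≫ biprod.inl) (biprod.snd ≫ biprod.inr)
      (extendBracket biprod.fst biprod.fst biprod.inl brA)
      (extendBracket biprod.snd biprod.snd biprod.inr brH)
      (extendBracket biprod.snd biprod.fst biprod.inl α)
      (extendBracket biprod.snd biprod.fst biprod.inr β) := by
  constructor <;> apply bracketSupport_extendBracket <;> simp

theorem cobracketsSupport_biprod :
    CobracketsSupport (X := A ⊞ H) (biprod.fst ≫ biprod.inl) (biprod.snd ≫ biprod.inr)
      (extendCobracket biprod.inl biprod.inl biprod.fst δA)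
      (extendCobracket biprod.inr biprod.inr biprod.snd δH)
      (extendCobracket biprod.inr biprod.inl biprod.fst φ)
      (extendCobracket biprod.inr biprod.inl biprod.snd ψ) := by
  constructor <;> apply cobracketSupport_extendCobracket <;> simp

end Biprod

section Double

variable {C : Type u} [Category.{v} C] [Preadditive C] [HasBinaryBiproducts C] [MonoidalCategory C]
  [BraidedCategory C] {A H : C} (brA : A ⊗ A ⟶ A) (brH : H ⊗ H ⟶ H) (δA : A ⟶ A ⊗ A)
  (δH : H ⟶ H ⊗ H) (α : H ⊗ A ⟶ A) (β : H ⊗ A ⟶ H) (φ : A ⟶ H ⊗ A) (ψ : H ⟶ H ⊗ A)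

theorem doubleBracket_eq_totalBracket :
    doubleBracket brA brH α β = totalBracket
      (extendBracket biprod.fst biprod.fst biprod.inl brA)
      (extendBracket biprod.snd biprod.snd biprod.inr brH)
      (extendBracket biprod.snd biprod.fst biprod.inl α)
      (extendBracket biprod.snd biprod.fst biprod.inr β) := by
  simp only [doubleBracket, totalBracket, extendBracket, ← braiding_naturality_assoc,
    Preadditive.add_comp, Preadditive.sub_comp, Category.assoc]
  abel

theorem doubleCobracket_eq_totalCobracket :
    doubleCobracket δA δH φ ψ = totalCobracket
      (extendCobracket biprod.inl biprod.inl biprod.fst δA)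
      (extendCobracket biprod.inr biprod.inr biprod.snd δH)
      (extendCobracket biprod.inr biprod.inl biprod.fst φ)
      (extendCobracket biprod.inr biprod.inl biprod.snd ψ) := by
  simp only [doubleCobracket, totalCobracket, extendCobracket, braiding_naturality,
    Preadditive.comp_add, Preadditive.comp_sub, Category.assoc]
  abel

variable [MonoidalPreadditive C] {brA brH δA δH α β φ ψ}

/-- By naturality the double braiding restricts to the double braiding of each pair of summands. The
mixed pairs need symmetry between `A` and `H`, not just on each of them. -/
theorem isSymmetricOn_biprod (h : IsSymmetricOn ({A, H} : Set C)) :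
    IsSymmetricOn ({A ⊞ H} : Set C) := by
  rintro _ rfl _ rfl
  have key (U V : C) (hU : U ∈ ({A, H} : Set C)) (hV : V ∈ ({A, H} : Set C)) :
      (β_ U V).hom ≫ (β_ V U).hom = 𝟙 _ := by rw [h U hU V hV, Iso.inv_hom_id]
  rw [← cancel_mono (β_ (A ⊞ H) (A ⊞ H)).hom, Iso.inv_hom_id]
  apply biprod_tensor_biprod_hom_ext <;>
    rw [braiding_naturality_assoc, braiding_naturality, reassoc_of% key _ _ (by simp) (by simp),
      Category.comp_id]

end Double

/-! ### Transport of the axioms to the biproduct -/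

section Transport

variable {C : Type u} [Category.{v} C] [Preadditive C] [HasBinaryBiproducts C]
  [MonoidalCategory C] [MonoidalPreadditive C] [BraidedCategory C] {A H : C}
  {brA : A ⊗ A ⟶ A} {brH : H ⊗ H ⟶ H} {δA : A ⟶ A ⊗ A} {δH : H ⟶ H ⊗ H}
  {α : H ⊗ A ⟶ A} {β : H ⊗ A ⟶ H} {φ : A ⟶ H ⊗ A} {ψ : H ⟶ H ⊗ A}

theorem IsLieAlgebra.extend_left (h : IsLieAlgebra A brA)
    (hs : IsSymmetricOn ({A, H} : Set C)) :
    IsLieAlgebra (A ⊞ H) (extendBracket biprod.fst biprod.fst biprod.inl brA) := by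
  refine ⟨isSymmetricOn_biprod hs, ?_, ?_⟩
  · have := h.antisymm =≫ (biprod.inl : A ⟶ A ⊞ H)
    apply biprod_tensor_biprod_hom_ext <;> simp
    simpa using this
  · have := h.jacobi =≫ (biprod.inl : A ⟶ A ⊞ H)
    apply biprod_tensor_biprod_tensor_biprod_hom_ext <;> simp
    simpa using this

theorem IsLieAlgebra.extend_right (h : IsLieAlgebra H brH)
    (hs : IsSymmetricOn ({A, H} : Set C)) :
    IsLieAlgebra (A ⊞ H) (extendBracket biprod.snd biprod.snd biprod.inr brH) := by
  refine ⟨isSymmetricOn_biprod hs, ?_, ?_⟩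
  · have := h.antisymm =≫ (biprod.inr : H ⟶ A ⊞ H)
    apply biprod_tensor_biprod_hom_ext <;> simp
    simpa using this
  · have := h.jacobi =≫ (biprod.inr : H ⟶ A ⊞ H)
    apply biprod_tensor_biprod_tensor_biprod_hom_ext <;> simp
    simpa using this

theorem IsLieCoalgebra.extend_left (h : IsLieCoalgebra A δA)
    (hs : IsSymmetricOn ({A, H} : Set C)) :
    IsLieCoalgebra (A ⊞ H) (extendCobracket biprod.inl biprod.inl biprod.fst δA) := by
  have h₁ := h.coantisymm =≫ (biprod.inl ⊗ₘ biprod.inl : _ ⟶ (A ⊞ H) ⊗ (A ⊞ H))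
  have h₂ := h.cojacobi =≫
    (biprod.inl ⊗ₘ (biprod.inl ⊗ₘ biprod.inl) : _ ⟶ (A ⊞ H) ⊗ (A ⊞ H) ⊗ (A ⊞ H))
  refine ⟨isSymmetricOn_biprod hs, ?_, ?_⟩
  · apply biprod.hom_ext' <;> simp
    simpa using h₁
  · apply biprod.hom_ext' <;> simp
    simpa using h₂

theorem IsLieCoalgebra.extend_right (h : IsLieCoalgebra H δH)
    (hs : IsSymmetricOn ({A, H} : Set C)) :
    IsLieCoalgebra (A ⊞ H) (extendCobracket biprod.inr biprod.inr biprod.snd δH) := by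
  have h₁ := h.coantisymm =≫ (biprod.inr ⊗ₘ biprod.inr : _ ⟶ (A ⊞ H) ⊗ (A ⊞ H))
  have h₂ := h.cojacobi =≫
    (biprod.inr ⊗ₘ (biprod.inr ⊗ₘ biprod.inr) : _ ⟶ (A ⊞ H) ⊗ (A ⊞ H) ⊗ (A ⊞ H))
  refine ⟨isSymmetricOn_biprod hs, ?_, ?_⟩
  · apply biprod.hom_ext' <;> simp
    simpa using h₁
  · apply biprod.hom_ext' <;> simp
    simpa using h₂

/-- All terms of a given axiom read the same summand of the triple tensor power, namely the source
of the original axiom. There the claim is that axiom followed by an inclusion; elsewhere both sides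
are zero. -/
theorem IsMatchedPairLieAlgebras.extend (h : IsMatchedPairLieAlgebras brA brH α β)
    (hs : IsSymmetricOn ({A, H} : Set C)) :
    IsMatchedPairLieAlgebras (A := A ⊞ H) (H := A ⊞ H)
      (extendBracket biprod.fst biprod.fst biprod.inl brA)
      (extendBracket biprod.snd biprod.snd biprod.inr brH)
      (extendBracket biprod.snd biprod.fst biprod.inl α)
      (extendBracket biprod.snd biprod.fst biprod.inr β) := by
  have lm := h.leftModule
  have rm := h.rightModule
  unfold IsLeftModule at lm
  unfold IsRightModule at rm
  refine ⟨h.lieAlgebra_left.extend_left hs, h.lieAlgebra_right.extend_right hs, ?_, ?_, ?_, ?_⟩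
  · apply biprod_tensor_biprod_tensor_biprod_hom_ext <;> simp [reassoc_of% lm]
  · apply biprod_tensor_biprod_tensor_biprod_hom_ext <;> simp [reassoc_of% rm]
  · apply biprod_tensor_biprod_tensor_biprod_hom_ext <;> simp [reassoc_of% h.m1]
  · apply biprod_tensor_biprod_tensor_biprod_hom_ext <;> simp [reassoc_of% h.m2]

theorem IsMatchedPairLieCoalgebras.extend (h : IsMatchedPairLieCoalgebras δA δH φ ψ)
    (hs : IsSymmetricOn ({A, H} : Set C)) :
    IsMatchedPairLieCoalgebras (A := A ⊞ H) (H := A ⊞ H)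
      (extendCobracket biprod.inl biprod.inl biprod.fst δA)
      (extendCobracket biprod.inr biprod.inr biprod.snd δH)
      (extendCobracket biprod.inr biprod.inl biprod.fst φ)
      (extendCobracket biprod.inr biprod.inl biprod.snd ψ) := by
  have lm := h.leftComodule
  have rm := h.rightComodule
  unfold IsLeftComodule at lm
  unfold IsRightComodule at rm
  refine ⟨h.lieCoalgebra_left.extend_left hs, h.lieCoalgebra_right.extend_right hs,
    ?_, ?_, ?_, ?_⟩
  · apply biprod.hom_ext' <;> simp [reassoc_of% lm]
  · apply biprod.hom_ext' <;> simp [reassoc_of% rm]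
  · apply biprod.hom_ext' <;> simp [reassoc_of% h.cm1]
  · apply biprod.hom_ext' <;> simp [reassoc_of% h.cm2]

theorem IsDoubleMatchedPair.extend (h : IsDoubleMatchedPair brA brH δA δH α β φ ψ)
    (hs : IsSymmetricOn ({A, H} : Set C)) :
    IsDoubleMatchedPair (A := A ⊞ H) (H := A ⊞ H)
      (extendBracket biprod.fst biprod.fst biprod.inl brA)
      (extendBracket biprod.snd biprod.snd biprod.inr brH)
      (extendCobracket biprod.inl biprod.inl biprod.fst δA)
      (extendCobracket biprod.inr biprod.inr biprod.snd δH)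
      (extendBracket biprod.snd biprod.fst biprod.inl α)
      (extendBracket biprod.snd biprod.fst biprod.inr β)
      (extendCobracket biprod.inr biprod.inl biprod.fst φ)
      (extendCobracket biprod.inr biprod.inl biprod.snd ψ) := by
  have slb₁ := h.slb_left
  have slb₂ := h.slb_right
  -- Sums get distributed over the inclusions, so B5 can act as a rewrite rule only with a single
  -- composite on its left.
  have b5 := eq_sub_of_add_eq h.b5
  unfold cocycleRHS leftInfBraiding at slb₁
  unfold cocycleRHS rightInfBraiding at slb₂
  refine ⟨h.lieAlgebra_left.extend_left hs, h.lieAlgebra_right.extend_right hs,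
    h.lieCoalgebra_left.extend_left hs, h.lieCoalgebra_right.extend_right hs,
    ?_, ?_, ?_, ?_, ?_, ?_, ?_⟩
  · apply biprod_tensor_biprod_hom_ext <;> simp [cocycleRHS, leftInfBraiding, reassoc_of% slb₁]
  · apply biprod_tensor_biprod_hom_ext <;> simp [cocycleRHS, rightInfBraiding, reassoc_of% slb₂]
  · apply biprod_tensor_biprod_hom_ext <;> simp [reassoc_of% h.b1]
  · apply biprod_tensor_biprod_hom_ext <;> simp [reassoc_of% h.b2]
  · apply biprod_tensor_biprod_hom_ext <;> simp [reassoc_of% h.b3]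
  · apply biprod_tensor_biprod_hom_ext <;> simp [reassoc_of% h.b4]
  · apply biprod_tensor_biprod_hom_ext <;> simp [reassoc_of% b5]

end Transport

end BraidedLie

theorem theorem1p6 {C : Type u} [Category.{v} C] [Preadditive C] [HasZeroObject C] [HasBinaryBiproducts C]
    [MonoidalCategory C] [MonoidalPreadditive C] [BraidedCategory C]
    (A H : C) (hsymm : BraidedLie.IsSymmetricOn ({A, H} : Set C))
    (brA : A ⊗ A ⟶ A) (brH : H ⊗ H ⟶ H) (δA : A ⟶ A ⊗ A) (δH : H ⟶ H ⊗ H)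
    (α : H ⊗ A ⟶ A) (β : H ⊗ A ⟶ H) (φ : A ⟶ H ⊗ A) (ψ : H ⟶ H ⊗ A)
    (hLie : BraidedLie.IsMatchedPairLieAlgebras brA brH α β)
    (hCoLie : BraidedLie.IsMatchedPairLieCoalgebras δA δH φ ψ)
    (hDouble : BraidedLie.IsDoubleMatchedPair brA brH δA δH α β φ ψ) :
    BraidedLie.IsLieBialgebra (A ⊞ H)
      (BraidedLie.doubleBracket brA brH α β) (BraidedLie.doubleCobracket δA δH φ ψ) := by
  have hef : ((biprod.fst : A ⊞ H ⟶ A) ≫ biprod.inl) ≫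
      biprod.snd ≫ (biprod.inr : H ⟶ A ⊞ H) = 0 := by simp
  have hfe : ((biprod.snd : A ⊞ H ⟶ H) ≫ biprod.inr) ≫
      biprod.fst ≫ (biprod.inl : A ⟶ A ⊞ H) = 0 := by simp
  have hbr := BraidedLie.bracketsSupport_biprod brA brH α β
  have hcobr := BraidedLie.cobracketsSupport_biprod δA δH φ ψ
  rw [BraidedLie.doubleBracket_eq_totalBracket, BraidedLie.doubleCobracket_eq_totalCobracket]
  exact ⟨(hLie.extend hsymm).isLieAlgebra_totalBracket hef hfe hbr,
    (hCoLie.extend hsymm).isLieCoalgebra_totalCobracket hef hfe hcobr,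
    (hDouble.extend hsymm).compat hef hfe hbr hcobr⟩
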